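/- **Theorem 4.1.** Notation. For a set $A\subset\mathbb R^I$ ($I$ finite), the coordinate convex hull $\mathrm{cconv}\,A$ consists of all $x\in\mathbb R^I$ such that for every $\theta\in\{-1,1\}^I$ there is $y\in A$ with $y(i)\ge x(i)$ whenever $\theta(i)=1$ and $y(i)\le x(i)$ whenever $\theta(i)=-1$; $A$ is coordinate convex if $A=\mathrm{cconv}\,A$. For $A\subset\mathbb R^n$, the combinatorial dimension $v(A)$ is the largest rank of a coordinate projection $P$ (restriction to the coordinates in some $I\subset\{1,\dots,n\}$, of rank $\#I$) such that $\mathrm{cconv}(PA)$ contains a translate of the unit cube $P\{0,1\}^n$ ($v(\emptyset)=0$), and $v(A,t)=v(t^{-1}A)$ for $t>0$. For $1\le p<\infty$ let $B_p^n=\{x\in\mathbb R^n:|x(1)|^p+\dots+|x(n)|^p\le n\}$, and let $B_\infty^n=\{x\in\mathbb R^n:\max_i|x(i)|\le 1\}$. With $|\cdot|$ the Lebesgue measure (outer measure, for non-measurable sets), put $\mu_p(K)=|K\cap B_p^n|/|B_p^n|$. (i) There is an absolute constant $c>0$ such that for all integers $0<k\le n$, all $1\le p\le\infty$ and every set $K\subset\mathbb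 R^n$ with $\mu_p(K)>0$, $$v(K,t)\ \ge\ n-k\qquad\text{for}\qquad t=c\left(\frac kn\right)\mu_p(K)^{1/k}.$$ (ii) This is sharp up to the absolute constant: there is an absolute constant $C>0$ such that for all integers $0<k\le n$ and every $\delta>0$ there is a coordinate convex body $K\subset\mathbb R^n$ (a compact coordinate convex set with nonempty interior) with $|K|<\delta$ such that, for all $1\le p\le\infty$ and all $t>0$, $$v(K,t)>n-k\qquad\text{implies}\qquad t<C\left(\frac kn\right)\mu_p(K)^{1/k}.$$ -/

import Mathlib

open MeasureTheory
open scoped ENNReal Pointwise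

/-- The coordinate convex hull of a set `K ⊆ ℝ^ι`: all points `x` such that every choice of signs
`θ ∈ {-1, 1}^ι` admits a `y ∈ K` with `y i ≥ x i` where `θ i = 1` and `y i ≤ x i` where
`θ i = -1`. -/
def coordConvexHull {ι : Type*} (K : Set (ι → ℝ)) : Set (ι → ℝ) :=
  {x | ∀ θ : ι → ℤˣ, ∃ y ∈ K, ∀ i, (θ i = 1 → x i ≤ y i) ∧ (θ i = -1 → y i ≤ x i)}

/-- A set is coordinate convex if it coincides with its coordinate convex hull. -/
def IsCoordConvex {ι : Type*} (K : Set (ι → ℝ)) : Prop :=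
  coordConvexHull K = K

/-- The coordinate projection of `ℝ^n` onto `ℝ^I`; its rank is the cardinality of `I`. -/
def coordProj {n : ℕ} (I : Finset (Fin n)) (x : Fin n → ℝ) : I → ℝ :=
  fun i => x i

/-- The vertex set `{0, 1}^ι` of the unit cube of `ℝ^ι`. -/
def unitCube (ι : Type*) : Set (ι → ℝ) :=
  {z | ∀ i, z i = 0 ∨ z i = 1}

/-- The combinatorial dimension `v(A)`: the maximal rank of a coordinate projection `P` such that
the coordinate convex hull of `P A` contains some translate of the unit cube `P {0, 1}^n`.
(The ranks are at most `n`, so for nonempty `A` the supremum is a maximum.) -/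
noncomputable def combDim {n : ℕ} (A : Set (Fin n → ℝ)) : ℕ :=
  sSup {d | ∃ I : Finset (Fin n), I.card = d ∧
    ∃ h : I → ℝ, (fun z => h + z) '' unitCube I ⊆ coordConvexHull (coordProj I '' A)}

/-- The scale-sensitive combinatorial dimension `v(A, t) = v(t⁻¹ A)`, for `t > 0`. -/
noncomputable def combDimAt {n : ℕ} (A : Set (Fin n → ℝ)) (t : ℝ) : ℕ :=
  combDim (t⁻¹ • A)

/-- The unit ball `B_p^n` of the normalized space `L_p^n`, `1 ≤ p ≤ ∞`: the points with
`|x 1|^p + ⋯ + |x n|^p ≤ n` if `p < ∞`, and with `max |x i| ≤ 1` if `p = ∞`. -/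
def lpUnitBall (n : ℕ) (p : ℝ≥0∞) : Set (Fin n → ℝ) :=
  {x | (p ≠ ∞ → ∑ i, |x i| ^ p.toReal ≤ (n : ℝ)) ∧ (p = ∞ → ∀ i, |x i| ≤ 1)}

/-- `μ_p(K) = |K ∩ B_p^n| / |B_p^n|`, with `|·|` the Lebesgue measure (for a set that is not
measurable, the Lebesgue outer measure). -/
noncomputable def lpMeasure {n : ℕ} (p : ℝ≥0∞) (K : Set (Fin n → ℝ)) : ℝ :=
  volume.real (K ∩ lpUnitBall n p) / volume.real (lpUnitBall n p)

/-! Lower bound. The points of a set in a translate of the integer lattice inject into the cells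
they shatter (`exists_injOn_shattersCell`). Cells with the same coordinate set `I` are disjoint,
have volume one and lie in the projection to `I` of any solid set containing the given set; moreover
`#I` is at most the combinatorial dimension. Averaging over translates gives
`volume_le_sum_volume_coordProj`. For the ball, a projection to `I` has volume at most `(e/2)^(n -
#I)` times that of the ball, whatever `p` is (`volume_coordProj_le`). Applied to `t⁻¹ • (K ∩ B_p)`,
this bounds `μ_p(K)` by the sum of `(e t / 2)^(n - #I)` over `#I ≤ v(K, t)`, and a Chernoff estimate
(`sum_pow_card_le`) makes that sum too small if `v(K, t) < n - k`.

Sharpness. The extremal body is the `ε`-thickening of the coordinate subspaces of codimension `k`,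
inside the ball of `L_1^n`. More than `n - k` coordinates always include one of the `k` thin ones,
which forces `t ≤ 2ε`. Its volume is `O(ε)` for fixed `n`, while `μ_p` is at least `(εn / 16k)^k`:
squeezing any `k` moderate coordinates of a typical point of the ball gives many disjoint images
inside the body. -/

/-! ### Shattering of integer cells -/

/-- The integer set `S` shatters the cell with lower corner `g`, in the coordinates where `g` is
defined: every choice of sides of the cell is realized by a point of `S`. -/
def ShattersCell {ι : Type*} (S : Set (ι → ℤ)) (g : ι → Option ℤ) : Prop :=
  ∀ θ : ι → ℤˣ, ∃ y ∈ S, ∀ i, ∀ a ∈ g i, (θ i = 1 → a + 1 ≤ y i) ∧ (θ i = -1 → y i ≤ a)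

/-- Sauer–Shelah principle for integer cells: a finite set of integer points injects into the
family of the cells it shatters. -/
theorem exists_injOn_shattersCell (n : ℕ) (S : Set (Fin n → ℤ)) (hS : S.Finite) :
    ∃ φ : (Fin n → ℤ) → (Fin n → Option ℤ),
      Set.InjOn φ S ∧ ∀ x ∈ S, ShattersCell S (φ x) := by
  induction n with
  | zero =>
    exact ⟨fun _ _ => none, fun x _ y _ _ => Subsingleton.elim _ _,
      fun x hx _ => ⟨x, hx, fun i => i.elim0⟩⟩
  | succ n ih =>
    -- `low h` collects the tails whose fibre contains `h` and also a higher point. A point that is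
    -- not the top of its fibre gets a genuine edge starting at its own height; a top point gets a
    -- cell degenerate in coordinate `0`. Tops are determined by their tails, so injectivity
    -- survives.
    let low : ℤ → Set (Fin n → ℤ) := fun h =>
      {y | Fin.cons h y ∈ S ∧ ∃ b, h < b ∧ (Fin.cons b y : Fin (n + 1) → ℤ) ∈ S}
    have himg : (Fin.tail '' S : Set (Fin n → ℤ)).Finite := hS.image _
    have hlow : ∀ h, (low h).Finite := fun h => himg.subset fun y hy =>
      ⟨_, hy.1, Fin.tail_cons _ _⟩
    obtain ⟨φ₀, inj₀, sh₀⟩ := ih _ himg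
    choose φ₁ inj₁ sh₁ using fun h => ih _ (hlow h)
    classical
    let φ : (Fin (n + 1) → ℤ) → (Fin (n + 1) → Option ℤ) := fun x =>
      if Fin.tail x ∈ low (x 0) then Fin.cons (some (x 0)) (φ₁ (x 0) (Fin.tail x))
      else Fin.cons none (φ₀ (Fin.tail x))
    refine ⟨φ, ?_, ?_⟩
    · intro x hx y hy hxy
      by_cases h1 : Fin.tail x ∈ low (x 0) <;> by_cases h2 : Fin.tail y ∈ low (y 0)
      · simp only [φ, h1, h2, if_true, Fin.cons_inj] at hxy
        obtain ⟨h0, ht⟩ := hxy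
        have h0 : x 0 = y 0 := Option.some.inj h0
        rw [← h0] at ht h2
        have := inj₁ _ h1 h2 ht
        rw [← Fin.cons_self_tail x, ← Fin.cons_self_tail y, h0, this]
      · simp [φ, h1, h2, Fin.cons_inj] at hxy
      · simp [φ, h1, h2, Fin.cons_inj] at hxy
      · simp only [φ, h1, h2, if_false, Fin.cons_inj, true_and] at hxy
        have ht : Fin.tail x = Fin.tail y := inj₀ ⟨x, hx, rfl⟩ ⟨y, hy, rfl⟩ hxy
        have hx' : (Fin.cons (x 0) (Fin.tail x) : Fin (n + 1) → ℤ) ∈ S := by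
          rwa [Fin.cons_self_tail]
        have hy' : (Fin.cons (y 0) (Fin.tail x) : Fin (n + 1) → ℤ) ∈ S := by
          rwa [ht, Fin.cons_self_tail]
        have h0 : x 0 = y 0 := by
          rcases lt_trichotomy (x 0) (y 0) with h | h | h
          · exact absurd ⟨hx', _, h, hy'⟩ h1
          · exact h
          · rw [← ht] at h2
            exact absurd ⟨hy', _, h, hx'⟩ h2
        rw [← Fin.cons_self_tail x, ← Fin.cons_self_tail y, h0, ht]
    · intro x hx θ
      by_cases h1 : Fin.tail x ∈ low (x 0)
      · obtain ⟨y, ⟨hy, b, hb, hyb⟩, hsh⟩ := sh₁ _ _ h1 (Fin.tail θ)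
        rcases Int.units_eq_one_or (θ 0) with h | h
        · refine ⟨_, hyb, fun i => ?_⟩
          refine Fin.cases ?_ (fun i => ?_) i
          · simp only [φ, h1, if_true, Fin.cons_zero, Option.mem_def, Option.some.injEq, h]
            rintro a rfl
            exact ⟨fun _ => hb, fun h => absurd h (by decide)⟩
          · simpa only [φ, h1, if_true, Fin.cons_succ, Fin.tail] using hsh i
        · refine ⟨_, hy, fun i => ?_⟩
          refine Fin.cases ?_ (fun i => ?_) i
          · simp only [φ, h1, if_true, Fin.cons_zero, Option.mem_def, Option.some.injEq, h]
            rintro a rfl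
            exact ⟨fun h => absurd h (by decide), fun _ => le_rfl⟩
          · simpa only [φ, h1, if_true, Fin.cons_succ, Fin.tail] using hsh i
      · obtain ⟨_, ⟨y, hy, rfl⟩, hsh⟩ := sh₀ _ ⟨x, hx, rfl⟩ (Fin.tail θ)
        refine ⟨y, hy, fun i => ?_⟩
        refine Fin.cases ?_ (fun i => ?_) i
        · simp [φ, h1]
        · simpa only [φ, h1, if_false, Fin.cons_succ, Fin.tail] using hsh i

/-! ### Measurability of the hull and counting lattice points -/

theorem subset_coordConvexHull {ι : Type*} (A : Set (ι → ℝ)) : A ⊆ coordConvexHull A :=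
  fun x hx _ => ⟨x, hx, fun _ => ⟨fun _ => le_rfl, fun _ => le_rfl⟩⟩

/-- The hull is a finite intersection of reflected lower sets, and order-connected sets are
null-measurable. This is what allows an arbitrary `A`. -/
theorem nullMeasurableSet_coordConvexHull {ι : Type*} [Fintype ι] (A : Set (ι → ℝ)) :
    NullMeasurableSet (coordConvexHull A) := by
  classical
  have : coordConvexHull A = ⋂ θ : ι → ℤˣ,
      (fun x i => ((θ i : ℤ) : ℝ) * x i) ⁻¹'
        {u : ι → ℝ | ∃ y ∈ A, ∀ i, u i ≤ ((θ i : ℤ) : ℝ) * y i} := by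
    ext x
    simp only [coordConvexHull, Set.mem_ofPred_eq, Set.mem_iInter, Set.mem_preimage]
    refine forall_congr' fun θ => exists_congr fun y => and_congr_right fun _ =>
      forall_congr' fun i => ?_
    rcases Int.units_eq_one_or (θ i) with h | h <;> simp [h]
  rw [this]
  refine NullMeasurableSet.iInter fun θ => ?_
  refine NullMeasurableSet.preimage (Set.OrdConnected.nullMeasurableSet (IsLowerSet.ordConnected ?_))
    (volume_preserving_pi (f := fun i x => ((θ i : ℤ) : ℝ) * x) fun i => ?_).quasiMeasurePreserving
  · rintro a b hba ⟨y, hy, h⟩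
    exact ⟨y, hy, fun i => (hba i).trans (h i)⟩
  · rcases Int.units_eq_one_or (θ i) with h | h
    · simp only [h, Units.val_one, Int.cast_one, one_mul]
      exact MeasurePreserving.id (volume : Measure ℝ)
    · simpa [h] using Measure.measurePreserving_neg (volume : Measure ℝ)

/-- A set that meets every translate of the integer lattice in at most `M` points has volume at
most `M`. -/
theorem volume_le_of_card_lattice_le {n : ℕ} {A : Set (Fin n → ℝ)} (hA : NullMeasurableSet A)
    {M : ℝ≥0∞} (h : ∀ (x : Fin n → ℝ) (S : Finset (Fin n → ℤ)),
      (∀ z ∈ S, (x + fun i => (z i : ℝ)) ∈ A) → (S.card : ℝ≥0∞) ≤ M) :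
    volume A ≤ M := by
  classical
  obtain ⟨A₀, hsub, hmeas, hae⟩ := hA.exists_measurable_subset_ae_eq
  rw [← measure_congr hae]
  let Q : (Fin n → ℤ) → Set (Fin n → ℝ) := fun z =>
    Set.pi Set.univ fun i => Set.Ico (z i : ℝ) (z i + 1)
  have hQm : ∀ z, MeasurableSet (Q z) := fun z =>
    MeasurableSet.univ_pi fun i => measurableSet_Ico
  have hQd : Pairwise (Function.onFun Disjoint Q) := by
    intro z w hzw
    refine Set.disjoint_left.2 fun x hx hy => hzw ?_
    funext i
    rw [← Int.floor_eq_iff.2 (hx i trivial), ← Int.floor_eq_iff.2 (hy i trivial)]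
  have hQu : ⋃ z, Q z = Set.univ := by
    refine Set.eq_univ_of_forall fun x => Set.mem_iUnion.2 ⟨fun i => ⌊x i⌋, fun i _ => ?_⟩
    exact ⟨Int.floor_le _, Int.lt_floor_add_one _⟩
  have hQ0 : volume (Q 0) = 1 := by
    simp [Q, Real.volume_pi_Ico]
  -- Summed over `z`, this writes the volume as the average, over `x` in the unit cell, of the
  -- number of lattice translates of `x` in `A₀`.
  have key : ∀ z, volume (A₀ ∩ Q z) =
      ∫⁻ x in Q 0, Set.indicator A₀ 1 (x + fun i => (z i : ℝ)) := by
    intro z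
    have hpre : (fun x : Fin n → ℝ => x + fun i => (z i : ℝ)) ⁻¹' (A₀ ∩ Q z) =
        ((fun x => x + fun i => (z i : ℝ)) ⁻¹' A₀) ∩ Q 0 := by
      ext x
      simp only [Set.mem_preimage, Set.mem_inter_iff, Q, Set.mem_pi, Set.mem_univ, true_implies,
        Set.mem_Ico, Pi.add_apply, Pi.zero_apply, Int.cast_zero, zero_add]
      refine and_congr_right fun _ => forall_congr' fun i => ?_
      constructor <;> rintro ⟨h1, h2⟩ <;> constructor <;> linarith
    rw [← measure_preimage_add_right volume (fun i => (z i : ℝ)) (A₀ ∩ Q z), hpre,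
      ← Measure.restrict_apply (hmeas.preimage (measurable_add_const _)),
      ← lintegral_indicator_one (hmeas.preimage (measurable_add_const _))]
    rfl
  calc volume A₀ = volume (⋃ z, A₀ ∩ Q z) := by rw [← Set.inter_iUnion, hQu, Set.inter_univ]
    _ = ∑' z, volume (A₀ ∩ Q z) := measure_iUnion
        (fun z w hzw => (hQd hzw).mono Set.inter_subset_right Set.inter_subset_right)
        (fun z => hmeas.inter (hQm z))
    _ = ∫⁻ x in Q 0, ∑' z : Fin n → ℤ, Set.indicator A₀ 1 (x + fun i => (z i : ℝ)) := by
        simp_rw [key]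
        rw [lintegral_tsum fun z => ?_]
        exact ((measurable_one.indicator hmeas).comp (measurable_add_const _)).aemeasurable
    _ ≤ ∫⁻ x in Q 0, M := by
        refine lintegral_mono fun x => ?_
        rw [ENNReal.tsum_eq_iSup_sum]
        refine iSup_le fun s => ?_
        refine le_trans (le_of_eq ?_)
          (h x (s.filter fun z => (x + fun i => (z i : ℝ)) ∈ A₀) fun z hz =>
            hsub (Finset.mem_filter.1 hz).2)
        simp [Set.indicator_apply]
    _ = M := by simp [hQ0]

/-! ### Volume and combinatorial dimension -/

/-- A solid set contains with `y` every `x` whose coordinates are dominated by those of `y`. -/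
def IsSolidSet {ι : Type*} (B : Set (ι → ℝ)) : Prop :=
  ∀ x, ∀ y ∈ B, (∀ i, |x i| ≤ |y i|) → x ∈ B

theorem IsSolidSet.smul {ι : Type*} {B : Set (ι → ℝ)} (hB : IsSolidSet B) {r : ℝ} (hr : r ≠ 0) :
    IsSolidSet (r • B) := by
  rintro x _ ⟨y, hy, rfl⟩ h
  refine ⟨r⁻¹ • x, hB _ y hy fun i => ?_, smul_inv_smul₀ hr x⟩
  have := h i
  simp only [Pi.smul_apply, smul_eq_mul, abs_mul, abs_inv] at this ⊢
  rwa [inv_mul_le_iff₀ (abs_pos.2 hr)]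

theorem card_le_combDim {n : ℕ} {A : Set (Fin n → ℝ)} (I : Finset (Fin n)) (h : I → ℝ)
    (hh : (fun z => h + z) '' unitCube I ⊆ coordConvexHull (coordProj I '' A)) :
    I.card ≤ combDim A := by
  refine le_csSup ⟨n, ?_⟩ ⟨I, rfl, h, hh⟩
  rintro d ⟨J, rfl, -⟩
  simpa using Finset.card_le_univ J

/-- The volume of a set is controlled by its combinatorial dimension and the volumes of the
coordinate projections of a solid set containing it. -/
theorem volume_le_sum_volume_coordProj {n : ℕ} {A D : Set (Fin n → ℝ)} (hAD : A ⊆ D)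
    (hD : IsSolidSet D) :
    volume A ≤ ∑ I : Finset (Fin n) with I.card ≤ combDim A, volume (coordProj I '' D) := by
  classical
  -- Passing to the hull restores measurability and costs nothing: the same `θ` turns a shattering
  -- hull point into a point of `A` at least as far out.
  refine (measure_mono (subset_coordConvexHull A)).trans
    (volume_le_of_card_lattice_le (nullMeasurableSet_coordConvexHull A) fun x S hS => ?_)
  obtain ⟨φ, hinj, hsh⟩ := exists_injOn_shattersCell n (S : Set (Fin n → ℤ)) S.finite_toSet
  let supp : (Fin n → ℤ) → Finset (Fin n) := fun z => Finset.univ.filter fun i => (φ z i).isSome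
  have hdom : ∀ z ∈ S, ∀ θ : Fin n → ℤˣ, ∃ y ∈ A, ∀ i, ∀ a ∈ φ z i,
      (θ i = 1 → x i + a + 1 ≤ y i) ∧ (θ i = -1 → y i ≤ x i + a) := by
    intro z hz θ
    obtain ⟨w, hw, hwz⟩ := hsh z hz θ
    obtain ⟨y, hy, hyw⟩ := hS w hw θ
    refine ⟨y, hy, fun i a ha => ⟨fun h => ?_, fun h => ?_⟩⟩
    · have h1 := (hyw i).1 h
      have h2 : ((a + 1 : ℤ) : ℝ) ≤ w i := Int.cast_le.2 ((hwz i a ha).1 h)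
      push_cast at h2
      simp only [Pi.add_apply] at h1
      linarith
    · have h1 := (hyw i).2 h
      have h2 : (w i : ℝ) ≤ a := Int.cast_le.2 ((hwz i a ha).2 h)
      simp only [Pi.add_apply] at h1
      linarith
  have hsupp : ∀ z, ∀ i ∈ supp z, (φ z i).getD 0 ∈ φ z i := by
    intro z i hi
    obtain ⟨a, ha⟩ := Option.isSome_iff_exists.1 (Finset.mem_filter.1 hi).2
    simp [ha]
  have hcard : ∀ z ∈ S, (supp z).card ≤ combDim A := by
    intro z hz
    refine card_le_combDim (supp z) (fun i => x i + (φ z i).getD 0) ?_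
    rintro _ ⟨u, hu, rfl⟩ θ
    obtain ⟨y, hy, hyz⟩ := hdom z hz fun i => if hi : i ∈ supp z then θ ⟨i, hi⟩ else 1
    refine ⟨_, ⟨y, hy, rfl⟩, fun i => ?_⟩
    have := hyz i _ (hsupp z i i.2)
    simp only [i.2, dite_true] at this
    simp only [Pi.add_apply, coordProj]
    refine ⟨fun h => (add_le_add_right ?_ _).trans (this.1 h),
      fun h => (this.2 h).trans (le_add_of_nonneg_right ?_)⟩
    · rcases hu i with h | h <;> simp [h]
    · rcases hu i with h | h <;> simp [h]
  have hmaps : (S : Set (Fin n → ℤ)).MapsTo supp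
      (Finset.univ.filter fun I : Finset (Fin n) => I.card ≤ combDim A) := fun z hz => by
    simpa using hcard z hz
  -- Group the lattice points by the support of their cell and count each group as the volume of a
  -- union of disjoint unit cells.
  rw [Finset.card_eq_sum_card_fiberwise hmaps, Nat.cast_sum]
  refine Finset.sum_le_sum fun I _ => ?_
  let cell : (Fin n → ℤ) → Set (I → ℝ) := fun z => Set.pi Set.univ fun i =>
    Set.Ico (x i + (φ z i).getD 0) (x i + (φ z i).getD 0 + 1)
  have hvol : ∀ z, volume (cell z) = 1 := fun z => by simp [cell, Real.volume_pi_Ico]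
  calc ((S.filter fun z => supp z = I).card : ℝ≥0∞)
      = ∑ z ∈ S.filter fun z => supp z = I, volume (cell z) := by simp [hvol]
    _ = volume (⋃ z ∈ S.filter fun z => supp z = I, cell z) := by
        refine (measure_biUnion_finset ?_ fun z _ =>
          MeasurableSet.univ_pi fun i => measurableSet_Ico).symm
        intro z hz w hw hzw
        simp only [Finset.coe_filter, Set.mem_ofPred_eq] at hz hw
        refine Set.disjoint_left.2 fun u hu hu' => hzw (hinj hz.1 hw.1 ?_)
        funext i
        by_cases hi : i ∈ I
        · have e1 := hsupp z i (hz.2 ▸ hi)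
          have e2 := hsupp w i (hw.2 ▸ hi)
          rw [Option.mem_def] at e1 e2
          rw [e1, e2]
          have h1 := hu ⟨i, hi⟩ trivial
          have h2 := hu' ⟨i, hi⟩ trivial
          have f1 : ⌊u ⟨i, hi⟩ - x i⌋ = (φ z i).getD 0 :=
            Int.floor_eq_iff.2 ⟨by linarith [h1.1], by linarith [h1.2]⟩
          have f2 : ⌊u ⟨i, hi⟩ - x i⌋ = (φ w i).getD 0 :=
            Int.floor_eq_iff.2 ⟨by linarith [h2.1], by linarith [h2.2]⟩
          rw [← f1, f2]
        · have e1 : i ∉ supp z := hz.2 ▸ hi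
          have e2 : i ∉ supp w := hw.2 ▸ hi
          simp only [supp, Finset.mem_filter, Finset.mem_univ, true_and, Bool.not_eq_true,
            Option.isSome_eq_false_iff, Option.isNone_iff_eq_none] at e1 e2
          rw [e1, e2]
    _ ≤ volume (coordProj I '' D) := by
        refine measure_mono (Set.iUnion₂_subset fun z hz u hu => ?_)
        obtain ⟨hzS, rfl⟩ := Finset.mem_filter.1 hz
        let u' : Fin n → ℝ := fun i => if hi : i ∈ supp z then u ⟨i, hi⟩ else 0
        -- Choosing `θ` by the sign of `u'` makes `y` dominate `u'` in absolute value, so solidity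
        -- applies.
        obtain ⟨y, hy, hyz⟩ := hdom z hzS fun i => if 0 ≤ u' i then 1 else -1
        refine ⟨u', hD u' y (hAD hy) fun i => ?_, funext fun i => by simp [u', coordProj]⟩
        by_cases hi : i ∈ supp z
        · have h1 := hyz i _ (hsupp z i hi)
          have h2 := hu ⟨i, hi⟩ trivial
          have h3 : u' i = u ⟨i, hi⟩ := by simp [u', hi]
          by_cases h0 : 0 ≤ u' i
          · simp only [h0, if_true, true_implies] at h1
            exact abs_le_abs_of_nonneg h0 (by linarith [h1.1, h2.2])
          · simp only [h0, if_false, true_implies] at h1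
            exact abs_le_abs_of_nonpos (not_le.1 h0).le (by linarith [h1.2, h2.1])
        · simp [u', hi]

/-! ### The balls and their coordinate projections -/

theorem isSolidSet_lpUnitBall (n : ℕ) (p : ℝ≥0∞) : IsSolidSet (lpUnitBall n p) := by
  rintro x y ⟨h1, h2⟩ hxy
  exact ⟨fun hp => (Finset.sum_le_sum fun i _ => Real.rpow_le_rpow (abs_nonneg _) (hxy i)
    ENNReal.toReal_nonneg).trans (h1 hp), fun hp i => (hxy i).trans (h2 hp i)⟩

theorem one_le_toReal_of_ne_top {p : ℝ≥0∞} (hp : 1 ≤ p) (h : p ≠ ∞) : 1 ≤ p.toReal := by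
  simpa using (ENNReal.toReal_le_toReal ENNReal.one_ne_top h).2 hp

/-- Shrinking the coordinates in `I` of a point of the ball by the factor `#I / n` makes room for
arbitrary coordinates in `[-1, 1]` outside of `I`. -/
theorem mem_lpUnitBall_of_shrink {n : ℕ} {p : ℝ≥0∞} (hp : 1 ≤ p) {y : Fin n → ℝ}
    (hy : y ∈ lpUnitBall n p) (I : Finset (Fin n)) {x : Fin n → ℝ}
    (hI : ∀ i ∈ I, |x i| ≤ (I.card / n : ℝ) * |y i|) (hI' : ∀ i ∉ I, |x i| ≤ 1) :
    x ∈ lpUnitBall n p := by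
  have hcard : (I.card : ℝ) ≤ n := by exact_mod_cast (by simpa using Finset.card_le_univ I)
  set s : ℝ := I.card / n with hs
  have hs0 : 0 ≤ s := by positivity
  have hs1 : s ≤ 1 := div_le_one_of_le₀ hcard (Nat.cast_nonneg _)
  have hsn : s * n = I.card := by
    rcases eq_or_ne n 0 with rfl | hn
    · simp only [CharP.cast_eq_zero, mul_zero] at hcard ⊢
      exact le_antisymm (Nat.cast_nonneg _) hcard
    · rw [hs, div_mul_cancel₀]
      exact_mod_cast hn
  refine ⟨fun h => ?_, fun h i => ?_⟩
  · have hp1 := one_le_toReal_of_ne_top hp h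
    have hp0 : 0 ≤ p.toReal := zero_le_one.trans hp1
    rw [← Finset.sum_add_sum_compl I]
    have h1 : ∑ i ∈ I, |x i| ^ p.toReal ≤ I.card := calc
      ∑ i ∈ I, |x i| ^ p.toReal ≤ ∑ i ∈ I, s * |y i| ^ p.toReal := by
          refine Finset.sum_le_sum fun i hi => ?_
          refine (Real.rpow_le_rpow (abs_nonneg _) (hI i hi) hp0).trans ?_
          rw [Real.mul_rpow hs0 (abs_nonneg _)]
          exact mul_le_mul_of_nonneg_right (Real.rpow_le_self_of_le_one hs0 hs1 hp1)
            (by positivity)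
      _ ≤ s * ∑ i, |y i| ^ p.toReal := by
          rw [Finset.mul_sum]
          exact Finset.sum_le_univ_sum_of_nonneg fun i => by positivity
      _ ≤ s * n := mul_le_mul_of_nonneg_left (hy.1 h) hs0
      _ = I.card := hsn
    have h2 : ∑ i ∈ Iᶜ, |x i| ^ p.toReal ≤ (n : ℝ) - I.card := calc
      ∑ i ∈ Iᶜ, |x i| ^ p.toReal ≤ ∑ i ∈ Iᶜ, 1 := Finset.sum_le_sum fun i hi =>
          Real.rpow_le_one (abs_nonneg _) (hI' i (Finset.mem_compl.1 hi)) hp0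
      _ = (n : ℝ) - I.card := by
          rw [Finset.sum_const, nsmul_eq_mul, mul_one, Finset.card_compl, Fintype.card_fin,
            Nat.cast_sub (by simpa using Finset.card_le_univ I)]
    linarith
  · by_cases hi : i ∈ I
    · exact (hI i hi).trans (mul_le_one₀ hs1 (abs_nonneg _) (hy.2 h i))
    · exact hI' i hi

theorem zero_mem_lpUnitBall {n : ℕ} {p : ℝ≥0∞} (hp : 1 ≤ p) : (0 : Fin n → ℝ) ∈ lpUnitBall n p := by
  refine ⟨fun h => ?_, fun _ i => by simp⟩
  have := one_le_toReal_of_ne_top hp h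
  simp [Real.zero_rpow (by linarith : p.toReal ≠ 0)]

theorem mem_lpUnitBall_of_abs_le_one {n : ℕ} {p : ℝ≥0∞} (hp : 1 ≤ p) {x : Fin n → ℝ}
    (hx : ∀ i, |x i| ≤ 1) : x ∈ lpUnitBall n p :=
  mem_lpUnitBall_of_shrink hp (zero_mem_lpUnitBall hp) ∅ (by simp) fun i _ => hx i

/-- For finite `p` this is Bernoulli's inequality `1 + p (a - 1) ≤ a ^ p`, summed over the
coordinates. -/
theorem sum_abs_le_of_mem_lpUnitBall {n : ℕ} {p : ℝ≥0∞} (hp : 1 ≤ p) {x : Fin n → ℝ}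
    (hx : x ∈ lpUnitBall n p) : ∑ i, |x i| ≤ n := by
  by_cases h : p = ∞
  · simpa using Finset.sum_le_sum fun i (_ : i ∈ (Finset.univ : Finset (Fin n))) => hx.2 h i
  · have hp1 := one_le_toReal_of_ne_top hp h
    have h1 : ∀ i, 1 + p.toReal * (|x i| - 1) ≤ |x i| ^ p.toReal := fun i => by
      simpa using one_add_mul_self_le_rpow_one_add
        (by linarith [abs_nonneg (x i)] : -1 ≤ |x i| - 1) hp1
    have h2 := (Finset.sum_le_sum fun i (_ : i ∈ Finset.univ) => h1 i).trans (hx.1 h)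
    rw [Finset.sum_add_distrib, ← Finset.mul_sum, Finset.sum_sub_distrib] at h2
    simp only [Finset.sum_const, Finset.card_univ, Fintype.card_fin, nsmul_eq_mul, mul_one] at h2
    nlinarith

theorem abs_le_of_mem_lpUnitBall {n : ℕ} {p : ℝ≥0∞} (hp : 1 ≤ p) {x : Fin n → ℝ}
    (hx : x ∈ lpUnitBall n p) (i : Fin n) : |x i| ≤ n :=
  (Finset.single_le_sum (f := fun i => |x i|) (fun i _ => abs_nonneg _) (Finset.mem_univ i)).trans
    (sum_abs_le_of_mem_lpUnitBall hp hx)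

theorem isClosed_lpUnitBall (n : ℕ) (p : ℝ≥0∞) : IsClosed (lpUnitBall n p) := by
  by_cases h : p = ∞
  · have : lpUnitBall n p = {x | ∀ i, |x i| ≤ 1} := by ext x; simp [lpUnitBall, h]
    rw [this, Set.ofPred_forall]
    exact isClosed_iInter fun i => isClosed_le (by fun_prop) continuous_const
  · have : lpUnitBall n p = {x | ∑ i, |x i| ^ p.toReal ≤ (n : ℝ)} := by
      ext x; simp [lpUnitBall, h]
    rw [this]
    refine isClosed_le (continuous_finsetSum _ fun i _ => ?_) continuous_const
    exact (continuous_apply i).abs.rpow_const fun _ => Or.inr ENNReal.toReal_nonneg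

theorem volume_setOf_abs_le {ι : Type*} [Fintype ι] (r : ι → ℝ) :
    volume {x : ι → ℝ | ∀ i, |x i| ≤ r i} = ∏ i, ENNReal.ofReal (2 * r i) := by
  have : {x : ι → ℝ | ∀ i, |x i| ≤ r i} = Set.Icc (fun i => -r i) r := by
    ext x
    simp only [Set.mem_ofPred_eq, abs_le, Set.mem_Icc, Pi.le_def, forall_and]
  rw [this, Real.volume_Icc_pi]
  exact Finset.prod_congr rfl fun i _ => by ring_nf

theorem volume_lpUnitBall_ne_top (n : ℕ) {p : ℝ≥0∞} (hp : 1 ≤ p) :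
    volume (lpUnitBall n p) ≠ ∞ := by
  refine ne_top_of_le_ne_top ?_ (measure_mono (t := {x : Fin n → ℝ | ∀ i, |x i| ≤ n})
    fun x hx => abs_le_of_mem_lpUnitBall hp hx)
  rw [volume_setOf_abs_le]
  exact ENNReal.prod_ne_top fun _ _ => ENNReal.ofReal_ne_top

theorem two_pow_le_volume_lpUnitBall (n : ℕ) {p : ℝ≥0∞} (hp : 1 ≤ p) :
    2 ^ n ≤ volume.real (lpUnitBall n p) := by
  have h := measure_mono (μ := volume) (s := {x : Fin n → ℝ | ∀ i, |x i| ≤ 1})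
    fun x hx => mem_lpUnitBall_of_abs_le_one hp hx
  rw [volume_setOf_abs_le] at h
  have := ENNReal.toReal_mono (volume_lpUnitBall_ne_top n hp) h
  simpa [measureReal_def] using this

theorem volume_lpUnitBall_pos (n : ℕ) {p : ℝ≥0∞} (hp : 1 ≤ p) :
    0 < volume.real (lpUnitBall n p) :=
  lt_of_lt_of_le (by positivity) (two_pow_le_volume_lpUnitBall n hp)

/-- The ball contains the product of its projection, shrunk by `#I / n`, with the cube `[-1, 1]` in
the other coordinates. -/
theorem volume_coordProj_mul_le {n : ℕ} {p : ℝ≥0∞} (hp : 1 ≤ p) (I : Finset (Fin n)) :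
    ENNReal.ofReal ((I.card / n : ℝ) ^ I.card) * volume (coordProj I '' lpUnitBall n p) *
      2 ^ (n - I.card) ≤ volume (lpUnitBall n p) := by
  set s : ℝ := I.card / n with hs
  have hs0 : 0 ≤ s := by positivity
  let e := MeasurableEquiv.piEquivPiSubtypeProd (fun _ : Fin n => ℝ) (· ∈ I)
  have he : MeasurePreserving e := by
    convert volume_preserving_piEquivPiSubtypeProd (fun _ : Fin n => ℝ) (· ∈ I)
  have hsub : e ⁻¹' ((s • (coordProj I '' lpUnitBall n p)) ×ˢ {z | ∀ i, |z i| ≤ 1}) ⊆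
      lpUnitBall n p := by
    rintro x ⟨⟨_, ⟨y, hy, rfl⟩, hyx⟩, hx2⟩
    refine mem_lpUnitBall_of_shrink hp hy I (fun i hi => ?_) fun i hi => hx2 ⟨i, hi⟩
    have : s * y i = x i := congrFun hyx ⟨i, hi⟩
    rw [← this, abs_mul, abs_of_nonneg hs0]
  have h := measure_mono (μ := volume) hsub
  rw [he.measure_preimage_equiv, Measure.volume_eq_prod, Measure.prod_prod,
    Measure.addHaar_smul, volume_setOf_abs_le] at h
  convert h using 2
  · rw [Module.finrank_fintype_fun_eq_card, Fintype.card_coe, abs_of_nonneg (by positivity)]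
  · simp [Fintype.card_subtype_compl]

/-- The inverse of the right side is `(1 + (n - d) / d) ^ d ≤ e ^ (n - d)`. -/
theorem exp_neg_le_div_pow {n d : ℕ} (hd : d ≤ n) :
    Real.exp (-((n - d : ℕ) : ℝ)) ≤ (d / n : ℝ) ^ d := by
  rcases Nat.eq_zero_or_pos d with rfl | hd0
  · simp
  have hn0 : (0 : ℝ) < n := by exact_mod_cast hd0.trans_le hd
  have hd0 : (0 : ℝ) < d := by exact_mod_cast hd0
  have h1 : (n / d : ℝ) ≤ Real.exp ((n - d : ℕ) / d) := by
    have := Real.add_one_le_exp (((n - d : ℕ) : ℝ) / d)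
    refine le_trans (le_of_eq ?_) this
    rw [Nat.cast_sub hd]
    field_simp
    ring
  have h2 := pow_le_pow_left₀ (by positivity) h1 d
  rw [← Real.exp_nat_mul, mul_div_cancel₀ _ hd0.ne'] at h2
  rw [Real.exp_neg, ← inv_div, inv_pow]
  exact inv_anti₀ (by positivity) h2

/-- Each dropped coordinate costs a factor `e / 2` independent of `p` and `n`; hence the absolute
constant. -/
theorem volume_coordProj_le {n : ℕ} {p : ℝ≥0∞} (hp : 1 ≤ p) (I : Finset (Fin n)) :
    volume (coordProj I '' lpUnitBall n p) ≤
      ENNReal.ofReal ((Real.exp 1 / 2) ^ (n - I.card) * volume.real (lpUnitBall n p)) := by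
  have hI : I.card ≤ n := by simpa using Finset.card_le_univ I
  have h := volume_coordProj_mul_le hp I
  have h1 := ENNReal.ofReal_le_ofReal (exp_neg_le_div_pow hI)
  have h2 : ENNReal.ofReal (Real.exp (-((n - I.card : ℕ) : ℝ)) * 2 ^ (n - I.card)) *
      volume (coordProj I '' lpUnitBall n p) ≤ volume (lpUnitBall n p) := by
    refine le_trans ?_ h
    rw [ENNReal.ofReal_mul (by positivity), mul_right_comm, ENNReal.ofReal_pow (by norm_num),
      ENNReal.ofReal_ofNat]
    gcongr
  have h3 : (Real.exp 1 / 2) ^ (n - I.card) =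
      (Real.exp (-((n - I.card : ℕ) : ℝ)) * 2 ^ (n - I.card))⁻¹ := by
    rw [mul_inv, ← Real.exp_neg, neg_neg, div_pow, ← Real.exp_nat_mul, mul_one, div_eq_mul_inv]
  rw [h3, ENNReal.ofReal_mul (by positivity), ENNReal.ofReal_inv_of_pos (by positivity),
    measureReal_def, ENNReal.ofReal_toReal (volume_lpUnitBall_ne_top n hp), mul_comm,
    ← div_eq_mul_inv, ENNReal.le_div_iff_mul_le (Or.inl (by positivity))
      (Or.inl ENNReal.ofReal_ne_top), mul_comm]
  exact h2

/-! ### The lower bound for the combinatorial dimension -/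

theorem coordConvexHull_mono {ι : Type*} {A B : Set (ι → ℝ)} (h : A ⊆ B) :
    coordConvexHull A ⊆ coordConvexHull B := fun _ hx θ =>
  let ⟨y, hy, hyx⟩ := hx θ
  ⟨y, h hy, hyx⟩

theorem combDim_mono {n : ℕ} {A B : Set (Fin n → ℝ)} (h : A ⊆ B) : combDim A ≤ combDim B := by
  have hle : ∀ d ∈ {d | ∃ I : Finset (Fin n), I.card = d ∧
      ∃ h : I → ℝ, (fun z => h + z) '' unitCube I ⊆ coordConvexHull (coordProj I '' A)},
      d ≤ combDim B := by
    rintro _ ⟨I, rfl, u, hu⟩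
    exact card_le_combDim I u (hu.trans (coordConvexHull_mono (Set.image_mono h)))
  rcases Set.eq_empty_or_nonempty {d | ∃ I : Finset (Fin n), I.card = d ∧
      ∃ h : I → ℝ, (fun z => h + z) '' unitCube I ⊆ coordConvexHull (coordProj I '' A)}
    with h0 | h0
  · rw [combDim, h0]
    simp
  · exact csSup_le h0 hle

theorem coordProj_image_smul {n : ℕ} (I : Finset (Fin n)) (r : ℝ) (A : Set (Fin n → ℝ)) :
    coordProj I '' (r • A) = r • (coordProj I '' A) :=
  Set.image_smul_comm (coordProj I) r A fun _ => rfl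

theorem lpMeasure_le_one {n : ℕ} {p : ℝ≥0∞} (hp : 1 ≤ p) (K : Set (Fin n → ℝ)) :
    lpMeasure p K ≤ 1 :=
  div_le_one_of_le₀ (measureReal_mono Set.inter_subset_right (volume_lpUnitBall_ne_top n hp))
    measureReal_nonneg

/-- The volume bound behind the theorem: a sum over the coordinate subspaces of dimension at most
the combinatorial dimension. -/
theorem lpMeasure_le_sum {n : ℕ} {p : ℝ≥0∞} (hp : 1 ≤ p) (K : Set (Fin n → ℝ)) {t : ℝ}
    (ht : 0 < t) :
    lpMeasure p K ≤ ∑ I : Finset (Fin n) with I.card ≤ combDimAt K t,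
      (Real.exp 1 / 2 * t) ^ (n - I.card) := by
  set B := lpUnitBall n p with hB
  set V := volume.real B with hV
  have hV0 : 0 < V := volume_lpUnitBall_pos n hp
  have hfin : volume (K ∩ B) ≠ ∞ := ne_top_of_le_ne_top (volume_lpUnitBall_ne_top n hp)
    (measure_mono Set.inter_subset_right)
  have h1 := volume_le_sum_volume_coordProj (A := t⁻¹ • (K ∩ B)) (D := t⁻¹ • B)
    (Set.smul_set_mono Set.inter_subset_right)
    ((isSolidSet_lpUnitBall n p).smul (inv_pos.2 ht).ne')
  have hdim : combDim (t⁻¹ • (K ∩ B)) ≤ combDimAt K t :=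
    combDim_mono (Set.smul_set_mono Set.inter_subset_left)
  have h2 : volume (t⁻¹ • (K ∩ B)) ≤
      ENNReal.ofReal (∑ I : Finset (Fin n) with I.card ≤ combDimAt K t,
        t⁻¹ ^ I.card * ((Real.exp 1 / 2) ^ (n - I.card) * V)) := by
    rw [ENNReal.ofReal_sum_of_nonneg fun I _ => by positivity]
    refine h1.trans ?_
    refine (Finset.sum_le_sum_of_subset
      (Finset.monotone_filter_right _ fun I _ hI => hI.trans hdim)).trans
      (Finset.sum_le_sum fun I _ => ?_)
    rw [coordProj_image_smul, Measure.addHaar_smul, Module.finrank_fintype_fun_eq_card,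
      Fintype.card_coe, abs_of_nonneg (by positivity), ENNReal.ofReal_mul (by positivity)]
    gcongr
    exact volume_coordProj_le hp I
  rw [Measure.addHaar_smul, Module.finrank_fintype_fun_eq_card, Fintype.card_fin,
    abs_of_nonneg (by positivity), ← ENNReal.ofReal_toReal hfin,
    ← ENNReal.ofReal_mul (by positivity), ENNReal.ofReal_le_ofReal_iff (by positivity)] at h2
  have h3 : lpMeasure p K * V = (volume (K ∩ B)).toReal := div_mul_cancel₀ _ hV0.ne'
  rw [← h3] at h2
  have h4 : t⁻¹ ^ n * V * lpMeasure p K ≤ t⁻¹ ^ n * V *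
      ∑ I : Finset (Fin n) with I.card ≤ combDimAt K t, (Real.exp 1 / 2 * t) ^ (n - I.card) := by
    rw [Finset.mul_sum]
    refine le_trans (le_of_eq (by ring)) (h2.trans (le_of_eq (Finset.sum_congr rfl fun I _ => ?_)))
    have hI : I.card ≤ n := by simpa using Finset.card_le_univ I
    have h5 : t⁻¹ ^ n * t ^ (n - I.card) = t⁻¹ ^ I.card := by
      rw [show t⁻¹ ^ n = t⁻¹ ^ I.card * t⁻¹ ^ (n - I.card) by
        rw [← pow_add, Nat.add_sub_of_le hI], mul_assoc, ← mul_pow, inv_mul_cancel₀ ht.ne', one_pow, mul_one]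
    rw [mul_pow, ← h5]
    ring
  exact le_of_mul_le_mul_left h4 (by positivity)

/-- Chernoff-type bound for the sum of `q ^ (n - #I)` over the sets `I` with `#I ≤ n - k`. -/
theorem sum_pow_card_le {n k d : ℕ} (hk : 0 < k) (hd : d + k ≤ n) {q : ℝ} (hq : 0 < q)
    (hqk : n * q ≤ k) :
    ∑ I : Finset (Fin n) with I.card ≤ d, q ^ (n - I.card) ≤ (Real.exp 1 * (n * q / k)) ^ k := by
  have hn0 : (0 : ℝ) < n := by exact_mod_cast (show 0 < n by omega)
  have hk0 : (0 : ℝ) < k := by exact_mod_cast hk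
  -- The Chernoff parameter minimizing `β ^ (-k) * exp (n q β)`. Since `β ≥ 1` and `n - #I ≥ k`,
  -- each term may be multiplied by `β ^ (n - #I - k)`.
  set β : ℝ := k / (n * q) with hβ
  have hβ1 : 1 ≤ β := (one_le_div (by positivity)).2 hqk
  have hβ0 : 0 < β := by positivity
  calc ∑ I : Finset (Fin n) with I.card ≤ d, q ^ (n - I.card)
      ≤ ∑ I : Finset (Fin n) with I.card ≤ d, (β ^ k)⁻¹ * (1 ^ I.card * (q * β) ^ (n - I.card)) := by
        refine Finset.sum_le_sum fun I hI => ?_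
        have hI := (Finset.mem_filter.1 hI).2
        rw [one_pow, one_mul, mul_pow, mul_left_comm]
        refine le_mul_of_one_le_right (by positivity) ?_
        rw [← div_eq_inv_mul, one_le_div (by positivity)]
        exact pow_le_pow_right₀ hβ1 (by omega)
    _ ≤ ∑ I : Finset (Fin n), (β ^ k)⁻¹ * (1 ^ I.card * (q * β) ^ (n - I.card)) :=
        Finset.sum_le_univ_sum_of_nonneg fun I => by positivity
    _ = (β ^ k)⁻¹ * (1 + q * β) ^ n := by rw [← Finset.mul_sum, Fin.sum_pow_mul_eq_add_pow]
    _ ≤ (β ^ k)⁻¹ * Real.exp (q * β) ^ n := by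
        gcongr
        linarith [Real.add_one_le_exp (q * β)]
    _ = (Real.exp 1 * (n * q / k)) ^ k := by
        have : (n : ℝ) * (q * β) = k * 1 := by rw [hβ]; field_simp
        rw [← Real.exp_nat_mul, this, Real.exp_nat_mul, mul_pow, mul_comm, ← inv_pow, hβ, inv_div]

theorem sub_le_combDimAt {n k : ℕ} (hk : 0 < k) (hkn : k ≤ n) {p : ℝ≥0∞} (hp : 1 ≤ p)
    {K : Set (Fin n → ℝ)} (hK : 0 < lpMeasure p K) :
    n - k ≤ combDimAt K (1 / 10 * ((k : ℝ) / (n : ℝ)) * lpMeasure p K ^ (1 / (k : ℝ))) := by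
  by_contra! hlt
  have hn0 : (0 : ℝ) < n := by exact_mod_cast (show 0 < n by omega)
  have hk0 : (0 : ℝ) < k := by exact_mod_cast hk
  set m := lpMeasure p K with hm
  set r := m ^ (1 / (k : ℝ)) with hr
  have hr0 : 0 < r := Real.rpow_pos_of_pos hK _
  have hr1 : r ≤ 1 := Real.rpow_le_one hK.le (lpMeasure_le_one hp K) (by positivity)
  have hrk : r ^ k = m := by
    rw [hr, ← Real.rpow_natCast, ← Real.rpow_mul hK.le, one_div_mul_cancel hk0.ne', Real.rpow_one]
  set t := 1 / 10 * ((k : ℝ) / (n : ℝ)) * r with ht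
  have ht0 : 0 < t := by positivity
  have he : Real.exp 1 < 3 := by linarith [Real.exp_one_lt_d9]
  have he0 := Real.exp_pos 1
  -- With `c = 1/10` the sum is at most `(e² r / 20) ^ k`, which is below `r ^ k = m` because `e² <
  -- 20`.
  have hq : (n : ℝ) * (Real.exp 1 / 2 * t) / k = Real.exp 1 / 20 * r := by
    rw [ht]; field_simp; norm_num
  have h1 := (lpMeasure_le_sum hp K ht0).trans
    (sum_pow_card_le hk (by omega) (by positivity) (by
      rw [← div_le_one hk0, hq]
      nlinarith))
  rw [hq] at h1
  have h2 : (Real.exp 1 * (Real.exp 1 / 20 * r)) ^ k < r ^ k := by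
    refine pow_lt_pow_left₀ ?_ (by positivity) hk.ne'
    have : Real.exp 1 * Real.exp 1 < 20 := by nlinarith
    nlinarith
  rw [hrk] at h2
  linarith

/-! ### The thickened cross -/

theorem combDim_le {n d : ℕ} {A : Set (Fin n → ℝ)} (hA : ∀ (I : Finset (Fin n)) (h : I → ℝ),
    (fun z => h + z) '' unitCube I ⊆ coordConvexHull (coordProj I '' A) → I.card ≤ d) :
    combDim A ≤ d := by
  rcases Set.eq_empty_or_nonempty {d | ∃ I : Finset (Fin n), I.card = d ∧
      ∃ h : I → ℝ, (fun z => h + z) '' unitCube I ⊆ coordConvexHull (coordProj I '' A)}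
    with h0 | h0
  · rw [combDim, h0]
    simp
  · refine csSup_le h0 ?_
    rintro _ ⟨I, rfl, h, hh⟩
    exact hA I h hh

theorem IsSolidSet.isCoordConvex {ι : Type*} {B : Set (ι → ℝ)} (hB : IsSolidSet B) :
    IsCoordConvex B := by
  refine Set.Subset.antisymm (fun x hx => ?_) (subset_coordConvexHull B)
  obtain ⟨y, hy, h⟩ := hx fun i => if 0 ≤ x i then 1 else -1
  refine hB x y hy fun i => ?_
  by_cases h0 : 0 ≤ x i
  · exact abs_le_abs_of_nonneg h0 ((h i).1 (if_pos h0))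
  · exact abs_le_abs_of_nonpos (not_le.1 h0).le ((h i).2 (if_neg h0))

/-- The union of the `ε`-neighbourhoods of the coordinate subspaces of codimension `k`, cut off by
the unit ball of `L_1^n`. -/
def thickCross (n k : ℕ) (ε : ℝ) : Set (Fin n → ℝ) :=
  {x | ∑ i, |x i| ≤ n ∧ ∃ J : Finset (Fin n), J.card = k ∧ ∀ i ∈ J, |x i| ≤ ε}

theorem isSolidSet_thickCross (n k : ℕ) (ε : ℝ) : IsSolidSet (thickCross n k ε) := by
  rintro x y ⟨h1, J, hJ, h2⟩ hxy
  exact ⟨(Finset.sum_le_sum fun i _ => hxy i).trans h1, J, hJ, fun i hi => (hxy i).trans (h2 i hi)⟩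

theorem isCompact_thickCross (n k : ℕ) (ε : ℝ) : IsCompact (thickCross n k ε) := by
  have hclosed : IsClosed (thickCross n k ε) := by
    have : thickCross n k ε = {x | ∑ i, |x i| ≤ (n : ℝ)} ∩
        ⋃ J : {J : Finset (Fin n) // J.card = k}, ⋂ i ∈ J.1, {x | |x i| ≤ ε} := by
      ext x
      simp [thickCross]
    rw [this]
    refine (isClosed_le (by fun_prop) continuous_const).inter
      (isClosed_iUnion_of_finite fun J => ?_)
    exact isClosed_biInter fun i _ => isClosed_le (by fun_prop) continuous_const
  refine isCompact_Icc.of_isClosed_subset (s := Set.Icc (fun _ => -(n : ℝ)) fun _ => n) hclosed ?_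
  intro x hx
  have h : ∀ i, |x i| ≤ n := fun i => (Finset.single_le_sum (f := fun i => |x i|)
    (fun i _ => abs_nonneg _) (Finset.mem_univ i)).trans hx.1
  exact ⟨fun i => (abs_le.1 (h i)).1, fun i => (abs_le.1 (h i)).2⟩

theorem mem_thickCross_of_abs_le {n k : ℕ} {ε : ℝ} {J : Finset (Fin n)} (hJ : J.card = k)
    {p : ℝ≥0∞} (hp : 1 ≤ p) {x : Fin n → ℝ} (hx : x ∈ lpUnitBall n p)
    (hxJ : ∀ i ∈ J, |x i| ≤ ε) : x ∈ thickCross n k ε :=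
  ⟨sum_abs_le_of_mem_lpUnitBall hp hx, J, hJ, hxJ⟩

theorem interior_thickCross_nonempty {n k : ℕ} (hkn : k ≤ n) {ε : ℝ} (hε : 0 < ε) :
    (interior (thickCross n k ε)).Nonempty := by
  obtain ⟨J, -, hJ⟩ := Finset.exists_subset_card_eq
    (s := (Finset.univ : Finset (Fin n))) (n := k) (by simpa using hkn)
  have hopen : IsOpen (⋂ i : Fin n, {x : Fin n → ℝ | |x i| < min ε 1}) :=
    isOpen_iInter_of_finite fun i => isOpen_lt (by fun_prop) continuous_const
  refine ⟨0, interior_maximal (fun x hx => ?_) hopen (by simp [hε])⟩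
  have hx : ∀ i, |x i| < min ε 1 := by simpa using hx
  exact mem_thickCross_of_abs_le hJ le_rfl
    (mem_lpUnitBall_of_abs_le_one le_rfl fun i => ((hx i).trans_le (min_le_right _ _)).le)
    fun i _ => ((hx i).trans_le (min_le_left _ _)).le

/-- If `#I > n - k`, then `I` meets every `J` of size `k`. A unit cube has a vertex whose
coordinates are all at least `1/2` in absolute value, while some coordinate of the dominating point
is at most `ε / t`. -/
theorem le_of_lt_combDimAt_thickCross {n k : ℕ} (hkn : k ≤ n) {ε t : ℝ} (ht : 0 < t)
    (h : n - k < combDimAt (thickCross n k ε) t) : t ≤ 2 * ε := by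
  by_contra! hεt
  refine absurd (combDim_le fun I u hu => ?_) (not_le.2 h)
  by_contra! hI
  -- The vertex is far from `0` in every coordinate at once, since `J` is known only after `y` is
  -- obtained.
  let z : I → ℝ := fun i => if 0 ≤ u i + 1 / 2 then 1 else 0
  have hz : z ∈ unitCube I := fun i => by
    by_cases h0 : 0 ≤ u i + 1 / 2 <;> simp only [z, h0, if_true, if_false] <;> tauto
  obtain ⟨_, ⟨_, ⟨y, ⟨-, J, hJ, hy⟩, rfl⟩, rfl⟩, hyu⟩ :=
    hu ⟨z, hz, rfl⟩ fun i => if 0 ≤ u i + 1 / 2 then 1 else -1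
  have hIJ : (I ∩ J).Nonempty := by
    rw [← Finset.card_pos]
    have h1 := Finset.card_union_add_card_inter I J
    have h2 : (I ∪ J).card ≤ n := by simpa using Finset.card_le_univ (I ∪ J)
    omega
  obtain ⟨i, hi⟩ := hIJ
  obtain ⟨hiI, hiJ⟩ := Finset.mem_inter.1 hi
  have h1 := hyu ⟨i, hiI⟩
  have h2 : (1 / 2 : ℝ) ≤ |t⁻¹ * y i| := by
    by_cases h0 : 0 ≤ u ⟨i, hiI⟩ + 1 / 2
    · have := h1.1 (if_pos h0)
      simp only [z, coordProj, h0, if_true, Pi.add_apply, Pi.smul_apply, smul_eq_mul] at this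
      exact le_trans (by linarith) (le_abs_self _)
    · have := h1.2 (if_neg h0)
      simp only [z, coordProj, h0, if_false, Pi.add_apply, Pi.smul_apply, smul_eq_mul] at this
      exact le_trans (by linarith) (neg_le_abs _)
  rw [abs_mul, abs_of_pos (inv_pos.2 ht), ← div_eq_inv_mul, le_div_iff₀ ht] at h2
  linarith [hy i hiJ]

/-- The points of `[-n, n]^n` near some coordinate hyperplane have small volume. -/
theorem volume_near_hyperplanes_le (n : ℕ) {ε : ℝ} (hε : 0 ≤ ε) :
    volume {x : Fin n → ℝ | (∀ i, |x i| ≤ n) ∧ ∃ i, |x i| ≤ ε} ≤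
      ENNReal.ofReal (n * (2 * n) ^ (n - 1) * 2 * ε) := by
  have hsub : {x : Fin n → ℝ | (∀ i, |x i| ≤ n) ∧ ∃ i, |x i| ≤ ε} ⊆
      ⋃ i : Fin n, {x | ∀ j, |x j| ≤ Function.update (fun _ => (n : ℝ)) i ε j} := by
    rintro x ⟨h1, i, h2⟩
    refine Set.mem_iUnion.2 ⟨i, fun j => ?_⟩
    rcases eq_or_ne j i with rfl | hj
    · simpa using h2
    · simpa [hj] using h1 j
  refine (measure_mono hsub).trans ((measure_iUnion_fintype_le _ _).trans ?_)
  have hvol : ∀ i : Fin n,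
      volume {x : Fin n → ℝ | ∀ j, |x j| ≤ Function.update (fun _ => (n : ℝ)) i ε j} =
        ENNReal.ofReal ((2 * n) ^ (n - 1) * (2 * ε)) := by
    intro i
    rw [volume_setOf_abs_le, ← Finset.mul_prod_erase _ _ (Finset.mem_univ i),
      Finset.prod_congr rfl (g := fun _ => ENNReal.ofReal (2 * n)) fun j hj => by
        rw [Function.update_of_ne (Finset.ne_of_mem_erase hj)]]
    rw [Finset.prod_const, Finset.card_erase_of_mem (Finset.mem_univ i), Finset.card_univ,
      Fintype.card_fin, Function.update_self, ← ENNReal.ofReal_pow (by positivity),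
      ← ENNReal.ofReal_mul (by positivity), mul_comm]
  rw [Finset.sum_congr rfl fun i _ => hvol i, Finset.sum_const, Finset.card_univ, Fintype.card_fin,
    nsmul_eq_mul, ← ENNReal.ofReal_natCast, ← ENNReal.ofReal_mul (by positivity)]
  exact le_of_eq (by ring_nf)

theorem volume_thickCross_le {n k : ℕ} (hk : 0 < k) {ε : ℝ} (hε : 0 ≤ ε) :
    volume.real (thickCross n k ε) ≤ n * (2 * n) ^ (n - 1) * 2 * ε := by
  refine ENNReal.toReal_le_of_le_ofReal (by positivity)
    ((measure_mono ?_).trans (volume_near_hyperplanes_le n hε))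
  rintro x ⟨h1, J, hJ, h2⟩
  obtain ⟨i, hi⟩ := Finset.card_pos.1 (hJ ▸ hk)
  exact ⟨fun i => (Finset.single_le_sum (f := fun i => |x i|)
    (fun i _ => abs_nonneg _) (Finset.mem_univ i)).trans h1, i, h2 i hi⟩

/-! ### Lower bounds for the measure of the cross -/

/-- Induction on `k`, from `(m + 1) / (k + 1) ≤ m / k` and the absorption identity for binomial
coefficients. -/
theorem pow_le_choose_mul_pow {m k : ℕ} (h : k ≤ m) : m ^ k ≤ m.choose k * k ^ k := by
  induction k generalizing m with
  | zero => simp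
  | succ k ih =>
    obtain ⟨m, rfl⟩ : ∃ m', m = m' + 1 := ⟨m - 1, by omega⟩
    have hkm : k ≤ m := by omega
    have h1 : (m + 1) ^ k ≤ m.choose k * (k + 1) ^ k := by
      rcases Nat.eq_zero_or_pos k with rfl | hk
      · simp
      refine Nat.le_of_mul_le_mul_right ?_ (pow_pos hk k)
      calc (m + 1) ^ k * k ^ k = ((m + 1) * k) ^ k := (mul_pow _ _ _).symm
        _ ≤ (m * (k + 1)) ^ k := Nat.pow_le_pow_left (by nlinarith) k
        _ = m ^ k * (k + 1) ^ k := mul_pow _ _ _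
        _ ≤ m.choose k * k ^ k * (k + 1) ^ k := Nat.mul_le_mul_right _ (ih hkm)
        _ = m.choose k * (k + 1) ^ k * k ^ k := by ring
    calc (m + 1) ^ (k + 1) = (m + 1) * (m + 1) ^ k := pow_succ' _ _
      _ ≤ (m + 1) * (m.choose k * (k + 1) ^ k) := Nat.mul_le_mul_left _ h1
      _ = ((m + 1) * m.choose k) * (k + 1) ^ k := by ring
      _ = (m + 1).choose (k + 1) * (k + 1) ^ (k + 1) := by
          rw [Nat.add_one_mul_choose_eq, pow_succ]
          ring

/-- The ball lies in that of `L_1^n`, of volume `(2n)^n / n!`, and `n^n / n! ≤ e^n`. -/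
theorem volume_lpUnitBall_le {n : ℕ} (hn : 0 < n) {p : ℝ≥0∞} (hp : 1 ≤ p) :
    volume.real (lpUnitBall n p) ≤ (2 * Real.exp 1) ^ n := by
  have : Nonempty (Fin n) := ⟨⟨0, hn⟩⟩
  refine ENNReal.toReal_le_of_le_ofReal (by positivity) ?_
  have h1 := measure_mono (μ := volume)
    (t := {x : Fin n → ℝ | (∑ i, |x i| ^ (1 : ℝ)) ^ (1 / (1 : ℝ)) ≤ (n : ℝ)})
    fun x hx => by simpa using sum_abs_le_of_mem_lpUnitBall hp hx
  refine h1.trans ?_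
  rw [volume_sum_rpow_le (Fin n) (le_refl 1) (n : ℝ), Fintype.card_fin,
    ← ENNReal.ofReal_pow (by positivity), ← ENNReal.ofReal_mul (by positivity)]
  refine ENNReal.ofReal_le_ofReal ?_
  have h2 : Real.Gamma (1 / 1 + 1) = 1 := by norm_num
  rw [h2, div_one, Real.Gamma_nat_eq_factorial, mul_one, mul_pow, ← Real.exp_nat_mul, mul_one]
  have h3 := Real.pow_div_factorial_le_exp (n : ℝ) (Nat.cast_nonneg n) n
  calc (n : ℝ) ^ n * (2 ^ n / n.factorial) = 2 ^ n * (n ^ n / n.factorial) := by ring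
    _ ≤ 2 ^ n * Real.exp n := by gcongr

/-- One box suffices: side `2ε` on a single `J`, side `2` elsewhere. The loss `e ^ n ≤ e ^ (2k)` is
absorbed by `16`, as `n ≤ 2k` and `e² ≤ 8`. -/
theorem le_lpMeasure_thickCross_of_lt_two_mul {n k : ℕ} (hk : 0 < k) (hkn : k ≤ n)
    (hnk : n < 2 * k) {ε : ℝ} (hε : 0 < ε) (hε1 : ε ≤ 1) {p : ℝ≥0∞} (hp : 1 ≤ p) :
    (ε * n / (16 * k)) ^ k ≤ lpMeasure p (thickCross n k ε) := by
  obtain ⟨J, -, hJ⟩ := Finset.exists_subset_card_eq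
    (s := (Finset.univ : Finset (Fin n))) (n := k) (by simpa using hkn)
  have hn : 0 < n := by omega
  have hk0 : (0 : ℝ) < k := by exact_mod_cast hk
  have hV := volume_lpUnitBall_pos n hp
  rw [lpMeasure, le_div_iff₀ hV]
  have hbox : 2 ^ n * ε ^ k ≤ volume.real (thickCross n k ε ∩ lpUnitBall n p) := by
    have h1 := measure_mono (μ := volume) (s := {x : Fin n → ℝ | ∀ i, |x i| ≤ if i ∈ J then ε else 1})
      (t := thickCross n k ε ∩ lpUnitBall n p) fun x hx => by
        have hB : x ∈ lpUnitBall n p := mem_lpUnitBall_of_abs_le_one hp fun i =>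
          (hx i).trans (by split_ifs <;> linarith)
        exact ⟨mem_thickCross_of_abs_le hJ hp hB fun i hi => by simpa [hi] using hx i, hB⟩
    have h2 := ENNReal.toReal_mono (ne_top_of_le_ne_top (volume_lpUnitBall_ne_top n hp)
      (measure_mono Set.inter_subset_right)) h1
    refine le_trans (le_of_eq ?_) h2
    rw [volume_setOf_abs_le, ENNReal.toReal_prod, Finset.prod_congr rfl
      (g := fun i => 2 * if i ∈ J then ε else 1) fun i _ =>
        ENNReal.toReal_ofReal (by split_ifs <;> linarith), Finset.prod_mul_distrib,
      Finset.prod_ite_mem, Finset.univ_inter, Finset.prod_const, Finset.prod_const, hJ,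
      Finset.card_univ, Fintype.card_fin]
  refine le_trans ?_ hbox
  have he0 := Real.exp_pos 1
  have he : Real.exp 1 < 2.72 := by linarith [Real.exp_one_lt_d9]
  have he1 : 1 ≤ Real.exp 1 := Real.one_le_exp zero_le_one
  have hnk' : (n : ℝ) ≤ 2 * k := by exact_mod_cast hnk.le
  calc (ε * n / (16 * k)) ^ k * volume.real (lpUnitBall n p)
      ≤ (ε / 8) ^ k * (2 * Real.exp 1) ^ n := by
        refine mul_le_mul (pow_le_pow_left₀ (by positivity) ?_ k) (volume_lpUnitBall_le hn hp)
          hV.le (by positivity)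
        rw [div_le_div_iff₀ (by positivity) (by norm_num)]
        nlinarith
    _ = 2 ^ n * ((ε / 8) ^ k * Real.exp 1 ^ n) := by rw [mul_pow]; ring
    _ ≤ 2 ^ n * ((ε / 8) ^ k * Real.exp 1 ^ (2 * k)) := by
        gcongr
    _ = 2 ^ n * (ε / 8 * Real.exp 1 ^ 2) ^ k := by rw [pow_mul, mul_pow]
    _ ≤ 2 ^ n * ε ^ k := by
        have : Real.exp 1 ^ 2 ≤ 8 := by nlinarith
        gcongr
        nlinarith

/-- The part of the ball that stays away from the coordinate hyperplanes. -/
def lpUnitBallAway (n : ℕ) (p : ℝ≥0∞) (ε : ℝ) : Set (Fin n → ℝ) :=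
  lpUnitBall n p ∩ ⋂ i, {x | ε < |x i|}

theorem measurableSet_lpUnitBallAway (n : ℕ) (p : ℝ≥0∞) (ε : ℝ) :
    MeasurableSet (lpUnitBallAway n p ε) :=
  (isClosed_lpUnitBall n p).measurableSet.inter (MeasurableSet.iInter fun i =>
    measurableSet_lt measurable_const (by fun_prop))

/-- The discarded part has volume at most `1/2`, and the ball has volume at least `2 ^ n ≥ 1`. -/
theorem volume_le_two_mul_volume_lpUnitBallAway {n : ℕ} {p : ℝ≥0∞} (hp : 1 ≤ p) {ε : ℝ}
    (hε : 0 ≤ ε) (hεn : n * (2 * n) ^ (n - 1) * 2 * ε ≤ 1 / 2) :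
    volume.real (lpUnitBall n p) ≤ 2 * volume.real (lpUnitBallAway n p ε) := by
  have hfin := volume_lpUnitBall_ne_top n hp
  have hsub : lpUnitBall n p ⊆ lpUnitBallAway n p ε ∪
      {x : Fin n → ℝ | (∀ i, |x i| ≤ n) ∧ ∃ i, |x i| ≤ ε} := by
    intro x hx
    by_cases h : ∃ i, |x i| ≤ ε
    · exact Or.inr ⟨abs_le_of_mem_lpUnitBall hp hx, h⟩
    · push Not at h
      exact Or.inl ⟨hx, Set.mem_iInter.2 h⟩
  have hN := volume_near_hyperplanes_le n hε
  have h1 := (measureReal_mono (μ := volume) hsub (measure_union_ne_top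
    (ne_top_of_le_ne_top hfin (measure_mono Set.inter_subset_left))
    (ne_top_of_le_ne_top ENNReal.ofReal_ne_top hN))).trans (measureReal_union_le _ _)
  have h2 := ENNReal.toReal_le_of_le_ofReal (by positivity) hN
  have h3 := two_pow_le_volume_lpUnitBall n hp
  have h4 : (1 : ℝ) ≤ 2 ^ n := one_le_pow₀ (by norm_num)
  rw [← measureReal_def] at h2
  linarith

theorem card_filter_abs_le_two_ge {n : ℕ} {x : Fin n → ℝ} (hx : ∑ i, |x i| ≤ n) :
    (n + 1) / 2 ≤ (Finset.univ.filter fun i => |x i| ≤ 2).card := by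
  have h1 := Finset.card_filter_add_card_filter_not
    (s := (Finset.univ : Finset (Fin n))) (fun i => |x i| ≤ 2)
  have h2 : ((Finset.univ.filter fun i => ¬ |x i| ≤ 2).card : ℝ) * 2 ≤ n := by
    refine le_trans ?_ hx
    rw [← nsmul_eq_mul]
    exact (Finset.card_nsmul_le_sum _ _ _ fun i hi => (not_le.1 (Finset.mem_filter.1 hi).2).le).trans
      (Finset.sum_le_univ_sum_of_nonneg fun i => abs_nonneg _)
  have h3 : (Finset.univ.filter fun i => ¬ |x i| ≤ 2).card * 2 ≤ n := by exact_mod_cast h2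
  rw [Finset.card_univ, Fintype.card_fin] at h1
  omega

/-- Double counting: by Markov's inequality at least half of the coordinates of a point of the ball
are at most `2` in absolute value. -/
theorem choose_mul_volume_le_sum {n : ℕ} (k : ℕ) {p : ℝ≥0∞} (hp : 1 ≤ p) (ε : ℝ) :
    (((n + 1) / 2).choose k : ℝ≥0∞) * volume (lpUnitBallAway n p ε) ≤
      ∑ J ∈ (Finset.univ : Finset (Fin n)).powersetCard k,
        volume (lpUnitBallAway n p ε ∩ ⋂ i ∈ J, {x | |x i| ≤ 2}) := by
  classical
  set G := lpUnitBallAway n p ε with hG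
  have hGm := measurableSet_lpUnitBallAway n p ε
  have hm : ∀ J : Finset (Fin n), MeasurableSet (⋂ i ∈ J, {x : Fin n → ℝ | |x i| ≤ 2}) := fun J =>
    Finset.measurableSet_biInter J fun i _ => measurableSet_le (by fun_prop) measurable_const
  calc (((n + 1) / 2).choose k : ℝ≥0∞) * volume G
      = ∫⁻ _ in G, (((n + 1) / 2).choose k : ℝ≥0∞) := (setLIntegral_const _ _).symm
    _ ≤ ∫⁻ x in G, ∑ J ∈ (Finset.univ : Finset (Fin n)).powersetCard k,
          Set.indicator (⋂ i ∈ J, {x : Fin n → ℝ | |x i| ≤ 2}) 1 x := by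
        refine setLIntegral_mono' hGm fun x hx => ?_
        have h1 := card_filter_abs_le_two_ge (sum_abs_le_of_mem_lpUnitBall hp hx.1)
        have h2 : (Finset.univ.filter fun i => |x i| ≤ 2).powersetCard k ⊆
            ((Finset.univ : Finset (Fin n)).powersetCard k).filter
              fun J => x ∈ ⋂ i ∈ J, {x : Fin n → ℝ | |x i| ≤ 2} := by
          intro J hJ
          obtain ⟨hJ1, hJ2⟩ := Finset.mem_powersetCard.1 hJ
          refine Finset.mem_filter.2
            ⟨Finset.mem_powersetCard.2 ⟨Finset.subset_univ _, hJ2⟩, Set.mem_iInter₂.2 fun i hi => ?_⟩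
          exact (Finset.mem_filter.1 (hJ1 hi)).2
        have h3 := Finset.card_le_card h2
        rw [Finset.card_powersetCard] at h3
        simp only [Set.indicator_apply, Pi.one_apply, Finset.sum_boole]
        exact_mod_cast (Nat.choose_le_choose k h1).trans h3
    _ = ∑ J ∈ (Finset.univ : Finset (Fin n)).powersetCard k,
          volume (G ∩ ⋂ i ∈ J, {x | |x i| ≤ 2}) := by
        rw [lintegral_finsetSum _ fun J _ => measurable_one.indicator (hm J)]
        refine Finset.sum_congr rfl fun J _ => ?_
        rw [lintegral_indicator_one (hm J), Measure.restrict_apply (hm J), Set.inter_comm]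

/-- Scale the coordinates in `J` by `ε / 2`. The images stay in the ball and in the cross, and are
disjoint for different `J`: the coordinates outside `J` still exceed `ε`, so `J` can be read off the
image. -/
theorem sum_volume_le_volume_thickCross {n k : ℕ} {p : ℝ≥0∞} (hp : 1 ≤ p) {ε : ℝ} (hε : 0 < ε)
    (hε1 : ε ≤ 1) :
    ENNReal.ofReal ((ε / 2) ^ k) * ∑ J ∈ (Finset.univ : Finset (Fin n)).powersetCard k,
        volume (lpUnitBallAway n p ε ∩ ⋂ i ∈ J, {x | |x i| ≤ 2}) ≤
      volume (thickCross n k ε ∩ lpUnitBall n p) := by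
  classical
  set G := lpUnitBallAway n p ε with hG
  let D : Finset (Fin n) → Set (Fin n → ℝ) := fun J => G ∩ ⋂ i ∈ J, {x | |x i| ≤ 2}
  have hDm : ∀ J, MeasurableSet (D J) := fun J =>
    (measurableSet_lpUnitBallAway n p ε).inter
      (Finset.measurableSet_biInter J fun i _ => measurableSet_le (by fun_prop) measurable_const)
  let w : Finset (Fin n) → Fin n → ℝ := fun J i => if i ∈ J then ε / 2 else 1
  have hw0 : ∀ J i, 0 < w J i := fun J i => by simp only [w]; split_ifs <;> positivity
  have hw1 : ∀ J i, w J i ≤ 1 := fun J i => by simp only [w]; split_ifs <;> linarith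
  let f : Finset (Fin n) → (Fin n → ℝ) →ₗ[ℝ] (Fin n → ℝ) := fun J =>
    Matrix.toLin' (Matrix.diagonal (w J))
  have hf : ∀ J x i, f J x i = w J i * x i := fun J x i => by
    simp [f, Matrix.toLin'_apply, Matrix.mulVec_diagonal]
  have hfinj : ∀ J, Function.Injective (f J) := fun J x y hxy => funext fun i => by
    have := congrFun hxy i
    rw [hf, hf] at this
    exact mul_left_cancel₀ (hw0 J i).ne' this
  have hdet : ∀ J, LinearMap.det (f J) = (ε / 2) ^ J.card := fun J => by
    rw [LinearMap.det_toLin', Matrix.det_diagonal]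
    simp only [w, Finset.prod_ite_mem, Finset.univ_inter, Finset.prod_const]
  have habs : ∀ J, ∀ x ∈ D J, ∀ i, |f J x i| ≤ ε ↔ i ∈ J := by
    rintro J x ⟨hx1, hx2⟩ i
    rw [hf, abs_mul, abs_of_pos (hw0 J i)]
    by_cases hi : i ∈ J
    · have h2 : |x i| ≤ 2 := Set.mem_iInter₂.1 hx2 i hi
      simp only [w, hi, if_true, iff_true]
      nlinarith
    · have h2 : ε < |x i| := Set.mem_iInter.1 hx1.2 i
      simpa [w, hi] using h2
  rw [Finset.mul_sum]
  calc ∑ J ∈ (Finset.univ : Finset (Fin n)).powersetCard k,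
        ENNReal.ofReal ((ε / 2) ^ k) * volume (D J)
      = ∑ J ∈ (Finset.univ : Finset (Fin n)).powersetCard k, volume (f J '' D J) := by
        refine Finset.sum_congr rfl fun J hJ => ?_
        rw [Measure.addHaar_image_linearMap, hdet, (Finset.mem_powersetCard.1 hJ).2,
          abs_of_nonneg (by positivity)]
    _ = volume (⋃ J ∈ (Finset.univ : Finset (Fin n)).powersetCard k, f J '' D J) := by
        refine (measure_biUnion_finset ?_ fun J _ => ?_).symm
        · intro J _ J' _ hJJ
          refine Set.disjoint_left.2 ?_
          rintro _ ⟨x, hx, rfl⟩ ⟨y, hy, hxy⟩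
          refine hJJ (Finset.ext fun i => ?_)
          rw [← habs J x hx i, ← habs J' y hy i, hxy]
        · exact (hDm J).image_of_continuousOn_injOn
            (LinearMap.continuous_of_finiteDimensional (f J)).continuousOn (hfinj J).injOn
    _ ≤ volume (thickCross n k ε ∩ lpUnitBall n p) := by
        refine measure_mono (Set.iUnion₂_subset fun J hJ => ?_)
        rintro _ ⟨x, hx, rfl⟩
        have hB : f J x ∈ lpUnitBall n p := isSolidSet_lpUnitBall n p _ x hx.1.1 fun i => by
          rw [hf, abs_mul, abs_of_pos (hw0 J i)]
          exact mul_le_of_le_one_left (abs_nonneg _) (hw1 J i)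
        exact ⟨mem_thickCross_of_abs_le (Finset.mem_powersetCard.1 hJ).2 hp hB
          fun i hi => (habs J x hx i).2 hi, hB⟩

theorem le_lpMeasure_thickCross_of_two_mul_le {n k : ℕ} (hk : 0 < k) (hnk : 2 * k ≤ n) {ε : ℝ}
    (hε : 0 < ε) (hε1 : ε ≤ 1) (hεn : n * (2 * n) ^ (n - 1) * 2 * ε ≤ 1 / 2) {p : ℝ≥0∞}
    (hp : 1 ≤ p) :
    (ε * n / (16 * k)) ^ k ≤ lpMeasure p (thickCross n k ε) := by
  have hk0 : (0 : ℝ) < k := by exact_mod_cast hk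
  have hV := volume_lpUnitBall_pos n hp
  have hfin : volume (thickCross n k ε ∩ lpUnitBall n p) ≠ ∞ := ne_top_of_le_ne_top
    (volume_lpUnitBall_ne_top n hp) (measure_mono Set.inter_subset_right)
  have h1 := (mul_le_mul_right (choose_mul_volume_le_sum (n := n) k hp ε)
    (ENNReal.ofReal ((ε / 2) ^ k))).trans (sum_volume_le_volume_thickCross hp hε hε1)
  have h2 := ENNReal.toReal_mono hfin h1
  rw [ENNReal.toReal_mul, ENNReal.toReal_mul, ENNReal.toReal_ofReal (by positivity),
    ENNReal.toReal_natCast, ← measureReal_def, ← measureReal_def] at h2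
  have h3 := volume_le_two_mul_volume_lpUnitBallAway hp hε.le hεn
  have h4 : (n / (2 * k) : ℝ) ^ k ≤ ((n + 1) / 2).choose k := by
    have h5 : ((((n + 1) / 2 : ℕ) : ℝ)) ^ k ≤ ((n + 1) / 2).choose k * (k : ℝ) ^ k := by
      exact_mod_cast pow_le_choose_mul_pow (m := (n + 1) / 2) (k := k) (by omega)
    have h6 : (n : ℝ) / 2 ≤ ((n + 1) / 2 : ℕ) := by
      rw [div_le_iff₀ two_pos]
      exact_mod_cast (by omega : n ≤ (n + 1) / 2 * 2)
    rw [← div_div, div_pow, div_le_iff₀ (by positivity)]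
    exact (pow_le_pow_left₀ (by positivity) h6 k).trans h5
  rw [lpMeasure, le_div_iff₀ hV]
  refine le_trans ?_ h2
  -- The choice of `k` coordinates and the scaling give `(εn / 4k)^k`; the factor `2` lost near the
  -- hyperplanes turns `4` into `16`.
  have h7 : (2 : ℝ) ≤ 4 ^ k := by
    calc (2 : ℝ) ≤ 4 ^ 1 := by norm_num
      _ ≤ 4 ^ k := pow_le_pow_right₀ (by norm_num) hk
  have h8 : (ε * n / (16 * k)) ^ k * 4 ^ k = (ε / 2) ^ k * (n / (2 * k) : ℝ) ^ k := by
    rw [← mul_pow, ← mul_pow]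
    congr 1
    field_simp
    ring
  calc (ε * n / (16 * k)) ^ k * volume.real (lpUnitBall n p)
      ≤ (ε * n / (16 * k)) ^ k * (4 ^ k * volume.real (lpUnitBallAway n p ε)) := by
        gcongr
        exact h3.trans (mul_le_mul_of_nonneg_right h7 measureReal_nonneg)
    _ = (ε / 2) ^ k * ((n / (2 * k) : ℝ) ^ k * volume.real (lpUnitBallAway n p ε)) := by
        rw [← mul_assoc, h8, mul_assoc]
    _ ≤ _ := by gcongr

theorem lt_of_lt_combDimAt_thickCross {n k : ℕ} (hk : 0 < k) (hkn : k ≤ n) {ε : ℝ}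
    (hε : 0 < ε) (hε1 : ε ≤ 1) (hεn : n * (2 * n) ^ (n - 1) * 2 * ε ≤ 1 / 2) {p : ℝ≥0∞}
    (hp : 1 ≤ p) {t : ℝ} (ht : 0 < t) (h : n - k < combDimAt (thickCross n k ε) t) :
    t < 64 * ((k : ℝ) / (n : ℝ)) * lpMeasure p (thickCross n k ε) ^ (1 / (k : ℝ)) := by
  have hk0 : (0 : ℝ) < k := by exact_mod_cast hk
  have hn0 : (0 : ℝ) < n := by exact_mod_cast hk.trans_le hkn
  have h1 : (ε * n / (16 * k)) ^ k ≤ lpMeasure p (thickCross n k ε) := by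
    rcases lt_or_ge n (2 * k) with hnk | hnk
    · exact le_lpMeasure_thickCross_of_lt_two_mul hk hkn hnk hε hε1 hp
    · exact le_lpMeasure_thickCross_of_two_mul_le hk hnk hε hε1 hεn hp
  have h2 := Real.rpow_le_rpow (by positivity) h1 (by positivity : 0 ≤ 1 / (k : ℝ))
  rw [one_div, Real.pow_rpow_inv_natCast (by positivity) hk.ne', ← one_div] at h2
  -- Relaxing `2ε` to `4ε` gives the strict inequality; `64 = 4 * 16`.
  calc t ≤ 2 * ε := le_of_lt_combDimAt_thickCross hkn ht h
    _ < 4 * ε := by linarith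
    _ = 64 * ((k : ℝ) / n) * (ε * n / (16 * k)) := by field_simp; norm_num
    _ ≤ _ := by gcongr

theorem theorem4p1 :
    (∃ c : ℝ, 0 < c ∧
      ∀ (n k : ℕ), 0 < k → k ≤ n →
      ∀ (p : ℝ≥0∞), 1 ≤ p →
      ∀ (K : Set (Fin n → ℝ)), 0 < lpMeasure p K →
        n - k ≤ combDimAt K (c * ((k : ℝ) / (n : ℝ)) * lpMeasure p K ^ (1 / (k : ℝ)))) ∧
    (∃ C : ℝ, 0 < C ∧
      ∀ (n k : ℕ), 0 < k → k ≤ n →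
      ∀ δ : ℝ, 0 < δ →
      ∃ K : Set (Fin n → ℝ),
        IsCompact K ∧ (interior K).Nonempty ∧ IsCoordConvex K ∧ volume.real K < δ ∧
        ∀ (p : ℝ≥0∞), 1 ≤ p → ∀ t : ℝ, 0 < t →
          n - k < combDimAt K t →
            t < C * ((k : ℝ) / (n : ℝ)) * lpMeasure p K ^ (1 / (k : ℝ))) := by
  refine ⟨⟨1 / 10, by norm_num, fun n k hk hkn p hp K hK => sub_le_combDimAt hk hkn hp hK⟩,
    64, by norm_num, fun n k hk hkn δ hδ => ?_⟩
  have hn0 : (0 : ℝ) < n := by exact_mod_cast hk.trans_le hkn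
  set η : ℝ := n * (2 * n) ^ (n - 1) * 2 with hη
  have hη0 : 0 < η := by positivity
  -- As `η ε` bounds the volume near the hyperplanes, `δ / 2` makes the body small and `1 / 2` keeps
  -- half of the ball away from them, for all `p` at once.
  set ε : ℝ := min 1 (min (δ / 2) (1 / 2) / η) with hε
  have hε0 : 0 < ε := by positivity
  have hηε : η * ε ≤ min (δ / 2) (1 / 2) := by
    rw [mul_comm, ← le_div_iff₀ hη0]
    exact min_le_right _ _
  refine ⟨thickCross n k ε, isCompact_thickCross n k ε, interior_thickCross_nonempty hkn hε0,
    (isSolidSet_thickCross n k ε).isCoordConvex, ?_, fun p hp t ht h =>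
      lt_of_lt_combDimAt_thickCross hk hkn hε0 (min_le_left _ _)
        (hηε.trans (min_le_right _ _)) hp ht h⟩
  linarith [volume_thickCross_le (n := n) hk hε0.le, hηε.trans (min_le_left _ _)]
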